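/- Let $K$ be a number field and let $S$ be a finite set of places of $K$ containing all the archimedean ones. Let $\mathcal{O}_{K,S}$ be the ring of $S$-integers of $K$, that is, of the $x\in K$ with $|x|_v\leq 1$ for all places $v\notin S$, and view $\mathcal{O}_{K,S}\subseteq K\subseteq\mathbb{P}^1(K)$ through $x\mapsto[x:1]$. Let $H:\mathbb{P}^1(K)\to[1,\infty)$ be the absolute multiplicative Weil height. For a set $T\subseteq\mathbb{P}^1(K)$ define the upper density $$\overline{\delta}_K(T):=\limsup_{B\to\infty}\frac{\#\{P\in T : H(P)\leq B\}}{\#\{P\in\mathbb{P}^1(K) : H(P)\leq B\}}.$$ Let $f:\mathbb{P}^1\to\mathbb{P}^1$ be a non-constant rational function defined over $K$, and let $$T(f,S):=\{b\in\mathbb{P}^1(K) : f(b)\in\mathcal{O}_{K,S}\}.$$ Then $\overline{\delta}_K(T(f,S))=0$. -/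

import Mathlib

open scoped LinearAlgebra.Projectivization

namespace IntegralDensity

noncomputable section

/-- The values at `v = (x, y)` of the two homogeneous forms `[F, G]` of degree
`d = max (deg num) (deg denom)` obtained from the coprime numerator and denominator of a rational
function. -/
def forms {K : Type*} [Field K] (f : RatFunc K) (v : Fin 2 → K) : Fin 2 → K :=
  ![MvPolynomial.eval v (f.num.homogenize (max f.num.natDegree f.denom.natDegree)),
    MvPolynomial.eval v (f.denom.homogenize (max f.num.natDegree f.denom.natDegree))]

theorem eval_homogenize_eq_sum {K : Type*} [Field K] (p : Polynomial K) (n : ℕ) (v : Fin 2 → K) :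
    MvPolynomial.eval v (p.homogenize n) =
      ∑ kl ∈ Finset.HasAntidiagonal.antidiagonal n, p.coeff kl.1 * (v 0 ^ kl.1 * v 1 ^ kl.2) := by
  rw [Polynomial.homogenize, map_sum]
  refine Finset.sum_congr rfl fun kl _ => ?_
  rw [MvPolynomial.eval_monomial, Finsupp.prod_fintype _ _ (by simp)]
  simp

theorem eval_homogenize_smul {K : Type*} [Field K] (p : Polynomial K) (n : ℕ) (t : K)
    (v : Fin 2 → K) :
    MvPolynomial.eval (t • v) (p.homogenize n) = t ^ n * MvPolynomial.eval v (p.homogenize n) := by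
  rw [eval_homogenize_eq_sum, eval_homogenize_eq_sum, Finset.mul_sum]
  refine Finset.sum_congr rfl fun kl hkl => ?_
  rw [← Finset.HasAntidiagonal.mem_antidiagonal.mp hkl]
  simp only [Pi.smul_apply, smul_eq_mul]
  ring

theorem eval_homogenize_of_eq_zero {K : Type*} [Field K] (p : Polynomial K) (n : ℕ)
    (v : Fin 2 → K) (hv : v 1 = 0) :
    MvPolynomial.eval v (p.homogenize n) = p.coeff n * v 0 ^ n := by
  rw [eval_homogenize_eq_sum, Finset.sum_eq_single (n, 0)]
  · simp
  · rintro ⟨k, l⟩ hkl hne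
    have hl : l ≠ 0 := by
      rintro rfl
      exact hne (by simpa using Finset.HasAntidiagonal.mem_antidiagonal.mp hkl)
    simp [hv, hl]
  · simp

theorem forms_smul {K : Type*} [Field K] (f : RatFunc K) (t : K) (v : Fin 2 → K) :
    forms f (t • v) = t ^ max f.num.natDegree f.denom.natDegree • forms f v := by
  ext i
  fin_cases i <;> simp [forms, eval_homogenize_smul]

theorem forms_ne_zero {K : Type*} [Field K] (f : RatFunc K) {v : Fin 2 → K} (hv : v ≠ 0) :
    forms f v ≠ 0 := by
  intro h
  have h0 := congrFun h 0
  have h1 := congrFun h 1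
  simp only [forms, Matrix.cons_val_zero, Matrix.cons_val_one, Pi.zero_apply] at h0 h1
  by_cases hy : v 1 = 0
  · have hx : v 0 ≠ 0 := by
      intro hx
      apply hv
      ext i
      fin_cases i
      · exact hx
      · exact hy
    rw [eval_homogenize_of_eq_zero _ _ _ hy] at h0 h1
    have hn := (mul_eq_zero.mp h0).resolve_right (pow_ne_zero _ hx)
    have hd := (mul_eq_zero.mp h1).resolve_right (pow_ne_zero _ hx)
    rcases le_total f.num.natDegree f.denom.natDegree with hle | hle
    · rw [max_eq_right hle] at hd
      exact f.denom_ne_zero (Polynomial.leadingCoeff_eq_zero.mp hd)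
    · rw [max_eq_left hle] at hn hd
      have hnum : f.num = 0 := Polynomial.leadingCoeff_eq_zero.mp hn
      have hdeg : f.denom.natDegree = f.num.natDegree :=
        le_antisymm hle (by simp [hnum])
      rw [← hdeg] at hd
      exact f.denom_ne_zero (Polynomial.leadingCoeff_eq_zero.mp hd)
  · rw [Polynomial.eval_homogenize (le_max_left _ _) _ hy] at h0
    rw [Polynomial.eval_homogenize (le_max_right _ _) _ hy] at h1
    have hn := (mul_eq_zero.mp h0).resolve_right (pow_ne_zero _ hy)
    have hd := (mul_eq_zero.mp h1).resolve_right (pow_ne_zero _ hy)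
    obtain ⟨a, b, hab⟩ := f.isCoprime_num_denom
    have := congrArg (Polynomial.eval (v 0 / v 1)) hab
    simp [hn, hd] at this

/-- The map `ℙ¹(K) → ℙ¹(K)`, `[x : y] ↦ [F(x, y) : G(x, y)]`, defined by a rational function. -/
def mapP1 {K : Type*} [Field K] (f : RatFunc K) : ℙ K (Fin 2 → K) → ℙ K (Fin 2 → K) :=
  Projectivization.lift
    (fun v => Projectivization.mk K (forms f v.1) (forms_ne_zero f v.2))
    (by
      rintro ⟨v, hv⟩ ⟨w, hw⟩ t rfl
      exact (Projectivization.mk_eq_mk_iff' _ _ _ _ _).mpr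
        ⟨t ^ max f.num.natDegree f.denom.natDegree, (forms_smul f t w).symm⟩)

/-- The point `[x : 1]` of `ℙ¹(K)`. -/
def affinePoint {K : Type*} [Field K] (x : K) : ℙ K (Fin 2 → K) :=
  Projectivization.mk K ![x, 1] (by simp)

/-- The set `T(f, S)` of the points `b` of `ℙ¹(K)` with `f(b) ∈ 𝒪_{K,S}`. Here `S` is the set of
the non-archimedean places in question; the archimedean places are all allowed implicitly. -/
def integralPreimage {K : Type*} [Field K] [NumberField K] (f : RatFunc K)
    (S : Set (IsDedekindDomain.HeightOneSpectrum (NumberField.RingOfIntegers K))) :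
    Set (ℙ K (Fin 2 → K)) :=
  {b | ∃ x ∈ S.integer K, mapP1 f b = affinePoint x}

/-- The absolute multiplicative height on `ℙ¹(K)`. (Mathlib's `mulHeight` is the height relative
to `K`.) -/
def absHeight {K : Type*} [Field K] [NumberField K] (P : ℙ K (Fin 2 → K)) : ℝ :=
  P.mulHeight ^ (Module.finrank ℚ K : ℝ)⁻¹

/-- The points of height at most `B` in a set `T` of points of `ℙ¹(K)`. -/
def boundedHeight {K : Type*} [Field K] [NumberField K] (T : Set (ℙ K (Fin 2 → K))) (B : ℝ) :
    Set (ℙ K (Fin 2 → K)) :=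
  {P | P ∈ T ∧ absHeight P ≤ B}

/-- Northcott: so `Set.ncard` below counts honestly. -/
theorem boundedHeight_finite {K : Type*} [Field K] [NumberField K] (T : Set (ℙ K (Fin 2 → K)))
    (B : ℝ) : (boundedHeight T B).Finite := by
  have hfin := NumberField.finite_setOfPred_mulHeight₁_le (K := K)
    (B ^ (Module.finrank ℚ K : ℝ))
  refine ((hfin.image affinePoint).insert
    (Projectivization.mk K ![1, 0] (by simp))).subset ?_
  rintro P ⟨-, hP⟩
  induction P using Projectivization.ind with | h v hv =>
  by_cases hy : v 1 = 0
  · left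
    refine (Projectivization.mk_eq_mk_iff' _ _ _ _ _).mpr ⟨v 0, ?_⟩
    ext i
    fin_cases i <;> simp [hy]
  · right
    have hmk : affinePoint (v 0 / v 1) = Projectivization.mk K v hv := by
      refine (Projectivization.mk_eq_mk_iff' _ _ _ _ _).mpr ⟨(v 1)⁻¹, ?_⟩
      ext i
      fin_cases i
      · simp [div_eq_inv_mul]
      · simp [hy]
    refine ⟨v 0 / v 1, ?_, hmk⟩
    rw [← hmk, absHeight, affinePoint, Projectivization.mulHeight_mk,
      ← Height.mulHeight₁_eq_mulHeight] at hP
    have h0 : (0 : ℝ) ≤ Height.mulHeight₁ (v 0 / v 1) := Height.mulHeight₁_nonneg _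
    have hd : (Module.finrank ℚ K : ℝ) ≠ 0 := Nat.cast_ne_zero.mpr Module.finrank_pos.ne'
    have := Real.rpow_le_rpow (Real.rpow_nonneg h0 _) hP
      (Nat.cast_nonneg (Module.finrank ℚ K))
    rwa [← Real.rpow_mul h0, inv_mul_cancel₀ hd, Real.rpow_one] at this

/-- The proportion of the points of `ℙ¹(K)` of height at most `B` that lie in `T`. -/
def proportion {K : Type*} [Field K] [NumberField K] (T : Set (ℙ K (Fin 2 → K))) (B : ℝ) : ℝ :=
  ((boundedHeight T B).ncard : ℝ) / ((boundedHeight (Set.univ : Set (ℙ K (Fin 2 → K))) B).ncard : ℝ)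

/-- The proportions lie in `[0, 1]`, so that the real `limsup` below is the honest one. -/
theorem proportion_mem_Icc {K : Type*} [Field K] [NumberField K] (T : Set (ℙ K (Fin 2 → K)))
    (B : ℝ) : proportion T B ∈ Set.Icc (0 : ℝ) 1 := by
  refine ⟨by unfold proportion; positivity, div_le_one_of_le₀ ?_ (Nat.cast_nonneg _)⟩
  exact_mod_cast Set.ncard_le_ncard (s := boundedHeight T B) (t := boundedHeight Set.univ B)
    (fun P hP => ⟨Set.mem_univ P, hP.2⟩) (boundedHeight_finite _ B)

/-- The upper density of a set of points of `ℙ¹(K)`, ordered by height. -/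
def upperDensity {K : Type*} [Field K] [NumberField K] (T : Set (ℙ K (Fin 2 → K))) : ℝ :=
  Filter.limsup (fun B : ℝ => proportion T B) Filter.atTop

end

end IntegralDensity

open scoped LinearAlgebra.Projectivization
open IsDedekindDomain NumberField
open scoped nonZeroDivisors

namespace IntegralDensity


/-! ### Elements of `K` that are `d`-th powers up to finitely many factors -/

section Selmer

variable {R : Type*} [CommRing R] [IsDedekindDomain R] {K : Type*} [Field K] [Algebra R K]
  [IsFractionRing R K]

/-! Write `f = [F : G]` with forms of degree `d ≥ 1`, and let `n = [K : ℚ]`. If `f([x : y])` is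
`S`-integral, then at every place outside `S` where `f` has good reduction `|G(x, y)| = max(|x|,
|y|)^d` (`valuation_eval_homogenize_eq`). So `G(x, y)` has valuation divisible by `d` outside a
finite set, and finiteness of the class group and finite generation of the units give `G(x, y) = c
w^d` with `c` in a finite set (`exists_finite_representatives_mod_pow`). Dividing the coordinates by
`w` makes them integral outside a finite set `S'` and puts them on one of finitely many curves `G =
c` (`exists_integral_representatives`).

On such a curve each coordinate has height at most a constant times that of the point
(`exists_mulHeight₁_coord_le`), and a suitable coordinate determines the other up to `d` choices
(`exists_fibre_polynomial`). Hence there are at most about as many points as `S'`-integers of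
absolute height `O(B)`, which is `O(B^n (log B + 1)^N)` (`exists_ncard_integral_le`). Already a
crude family of fractions gives at least a constant times `B^(n+1)` points of `ℙ¹(K)`
(`exists_ncard_boundedHeight_univ_ge`), so the proportion tends to `0`. -/

theorem valuation_eq_exp_neg_count (v : HeightOneSpectrum R) {a : K} (ha : a ≠ 0) :
    v.valuation K a =
      WithZero.exp (-FractionalIdeal.count K v (FractionalIdeal.spanSingleton R⁰ a)) := by
  classical
  obtain ⟨r, s, hs, rfl⟩ := IsFractionRing.div_surjective R a
  have hs0 : s ≠ 0 := nonZeroDivisors.ne_zero hs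
  have hr0 : r ≠ 0 := by rintro rfl; simp at ha
  have key : ∀ t : R, t ≠ 0 → v.valuation K (algebraMap R K t) =
      WithZero.exp (-FractionalIdeal.count K v
        (FractionalIdeal.spanSingleton R⁰ (algebraMap R K t))) := by
    intro t ht
    rw [HeightOneSpectrum.valuation_of_algebraMap, HeightOneSpectrum.intValuation_if_neg _ ht,
      ← FractionalIdeal.coeIdeal_span_singleton, FractionalIdeal.count_coe]
    simpa using ht
  rw [map_div₀, key r hr0, key s hs0, ← WithZero.exp_sub, div_eq_mul_inv,
    ← FractionalIdeal.spanSingleton_mul_spanSingleton, ← FractionalIdeal.spanSingleton_inv,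
    FractionalIdeal.count_mul, FractionalIdeal.count_inv]
  · congr 1; ring
  · simpa [FractionalIdeal.spanSingleton_eq_zero_iff] using hr0
  · simpa [FractionalIdeal.spanSingleton_eq_zero_iff] using hs0

theorem exists_unit_of_valuation_eq_one {a : K} (ha : a ≠ 0)
    (h : ∀ v : HeightOneSpectrum R, v.valuation K a = 1) : ∃ u : Rˣ, algebraMap R K u = a := by
  obtain ⟨r, hr⟩ := HeightOneSpectrum.mem_integers_of_valuation_le_one (R := R) K a
    fun v => (h v).le
  obtain ⟨s, hs⟩ := HeightOneSpectrum.mem_integers_of_valuation_le_one (R := R) K a⁻¹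
    fun v => by rw [map_inv₀, h v, inv_one]
  have hrs : r * s = 1 := by
    apply FaithfulSMul.algebraMap_injective R K
    rw [map_mul, hr, hs, mul_inv_cancel₀ ha, map_one]
  exact ⟨Units.mkOfMulEqOne r s hrs, hr⟩

/-- `I` and `J` carry the quotients by `d` of the exponents of `a` and `b`. Equal classes give `J =
I (t)`; as the remainders agree too, `b / (a t ^ d)` has trivial valuation everywhere and is a unit.
-/
theorem exists_units_mul_pow_eq_div {d : ℕ} {a b : K} (ha : a ≠ 0) (hb : b ≠ 0) {I J : (FractionalIdeal R⁰ K)ˣ}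
    (hI : ∀ v, FractionalIdeal.count K v (I : FractionalIdeal R⁰ K) =
      FractionalIdeal.count K v (FractionalIdeal.spanSingleton R⁰ a) / d)
    (hJ : ∀ v, FractionalIdeal.count K v (J : FractionalIdeal R⁰ K) =
      FractionalIdeal.count K v (FractionalIdeal.spanSingleton R⁰ b) / d)
    (hIJ : (I : (FractionalIdeal R⁰ K)ˣ ⧸ (toPrincipalIdeal R K).range) = J)
    (hmod : ∀ v, FractionalIdeal.count K v (FractionalIdeal.spanSingleton R⁰ a) % d =
      FractionalIdeal.count K v (FractionalIdeal.spanSingleton R⁰ b) % d) :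
    ∃ (u : Rˣ) (t : K), t ≠ 0 ∧ b = a * algebraMap R K u * t ^ d := by
  obtain ⟨t, ht⟩ := QuotientGroup.eq.mp hIJ
  have ht' : (J : FractionalIdeal R⁰ K) = I * FractionalIdeal.spanSingleton R⁰ (t : K) := by
    rw [toPrincipalIdeal_eq_iff] at ht
    rw [ht, ← Units.val_mul, mul_inv_cancel_left]
  have ht0 : (t : K) ≠ 0 := t.ne_zero
  obtain ⟨u, hu⟩ := exists_unit_of_valuation_eq_one (R := R) (a := b / (a * (t : K) ^ d))
    (by positivity) (by
      intro v
      have hc := congrArg (FractionalIdeal.count K v) ht'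
      rw [FractionalIdeal.count_mul K v I.ne_zero
        (by simp [FractionalIdeal.spanSingleton_eq_zero_iff]), hI, hJ] at hc
      have h1 := Int.mul_ediv_add_emod
        (FractionalIdeal.count K v (FractionalIdeal.spanSingleton R⁰ a)) d
      have h2 := Int.mul_ediv_add_emod
        (FractionalIdeal.count K v (FractionalIdeal.spanSingleton R⁰ b)) d
      rw [map_div₀, map_mul, map_pow, valuation_eq_exp_neg_count v ha,
        valuation_eq_exp_neg_count v hb, valuation_eq_exp_neg_count v ht0, ← WithZero.exp_nsmul,
        ← WithZero.exp_add, ← WithZero.exp_sub, ← WithZero.exp_zero]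
      congr 1
      rw [nsmul_eq_mul, ← h1, ← h2, hmod v, hc]
      ring)
  refine ⟨u, t, ht0, ?_⟩
  rw [hu]
  field_simp

theorem exists_unit_fractionalIdeal_count_eq_div (a : K) (d : ℕ) :
    ∃ I : (FractionalIdeal R⁰ K)ˣ, ∀ v, FractionalIdeal.count K v (I : FractionalIdeal R⁰ K) =
      FractionalIdeal.count K v (FractionalIdeal.spanSingleton R⁰ a) / d := by
  have hfin : ∀ᶠ v : HeightOneSpectrum R in Filter.cofinite,
      FractionalIdeal.count K v (FractionalIdeal.spanSingleton R⁰ a) / (d : ℤ) = 0 := by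
    filter_upwards [FractionalIdeal.finite_factors (FractionalIdeal.spanSingleton R⁰ a)] with v hv
    rw [hv, Int.zero_ediv]
  refine ⟨Units.mk0 (∏ᶠ v : HeightOneSpectrum R, (v.asIdeal : FractionalIdeal R⁰ K) ^
    (FractionalIdeal.count K v (FractionalIdeal.spanSingleton R⁰ a) / (d : ℤ))) ?_, fun v => ?_⟩
  · apply finprod_induction (fun I => I ≠ 0) one_ne_zero (fun _ _ => mul_ne_zero)
    exact fun v => zpow_ne_zero _ (FractionalIdeal.coeIdeal_ne_zero.mpr v.ne_bot)
  · exact FractionalIdeal.count_finprod K v _ hfin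

end Selmer

/-- Up to `d`-th powers there are only finitely many elements of a number field whose valuations
outside of a finite set are divisible by `d`. -/
theorem exists_finite_representatives_mod_pow {K : Type*} [Field K] [NumberField K]
    {S : Set (HeightOneSpectrum (𝓞 K))} (hS : S.Finite) {d : ℕ} (hd : 0 < d) :
    ∃ C : Set K, C.Finite ∧ 0 ∉ C ∧ ∀ a : K, a ≠ 0 →
      (∀ v ∉ S, ∃ t : K, v.valuation K a = v.valuation K t ^ d) →
        ∃ c ∈ C, ∃ w : K, w ≠ 0 ∧ a = c * w ^ d := by
  classical
  have : Finite S := hS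
  have : NeZero d := ⟨hd.ne'⟩
  have : Finite ((FractionalIdeal (𝓞 K)⁰ K)ˣ ⧸ (toPrincipalIdeal (𝓞 K) K).range) :=
    Finite.of_equiv _ (ClassGroup.equiv (R := 𝓞 K) K).toEquiv
  have : Group.FG (𝓞 K)ˣ := Group.fg_iff_monoid_fg.mpr inferInstance
  have := Subgroup.finiteIndex_iff_finite_quotient.mp
    (Subgroup.finiteIndex_range_powMonoidHom_of_fg (𝓞 K)ˣ hd.ne')
  let e : HeightOneSpectrum (𝓞 K) → K → ℤ := fun v a =>
    FractionalIdeal.count K v (FractionalIdeal.spanSingleton (𝓞 K)⁰ a)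
  choose I hI using fun a : K => exists_unit_fractionalIdeal_count_eq_div (R := 𝓞 K) a d
  -- `φ` records the class of the ideal of floored exponents and the exponents mod `d` on `S`;
  -- outside `S` the remainders vanish on `A`. Its target is finite.
  let A : Set K := {a | a ≠ 0 ∧ ∀ v ∉ S, (d : ℤ) ∣ e v a}
  let φ : A → ((FractionalIdeal (𝓞 K)⁰ K)ˣ ⧸ (toPrincipalIdeal (𝓞 K) K).range) × (S → ZMod d) :=
    fun a => ((I a : (FractionalIdeal (𝓞 K)⁰ K)ˣ), fun v => (e v a : ZMod d))
  -- One element of `A` for each value attained by `φ`, times one unit for each class modulo `d`-th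
  -- powers.
  let C : Set K := Set.range fun p : Set.range φ × ((𝓞 K)ˣ ⧸ (powMonoidHom d : (𝓞 K)ˣ →* _).range) =>
    (p.1.2.choose : K) * algebraMap (𝓞 K) K (p.2.out : (𝓞 K)ˣ)
  refine ⟨C, Set.finite_range _, ?_, fun a ha hv => ?_⟩
  · rintro ⟨p, hp⟩
    rcases mul_eq_zero.mp hp with h | h
    · exact p.1.2.choose.2.1 h
    · exact (by simp at h)
  · have haA : a ∈ A := by
      refine ⟨ha, fun v hvS => ?_⟩
      obtain ⟨t, ht⟩ := hv v hvS
      have ht0 : t ≠ 0 := by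
        rintro rfl
        rw [map_zero, zero_pow hd.ne', map_eq_zero] at ht
        exact ha ht
      rw [valuation_eq_exp_neg_count v ha, valuation_eq_exp_neg_count v ht0, ← WithZero.exp_nsmul,
        WithZero.exp_inj, nsmul_eq_mul] at ht
      exact ⟨e v t, by simp only [e]; linarith⟩
    let q : Set.range φ := ⟨φ ⟨a, haA⟩, _, rfl⟩
    have hq : φ q.2.choose = φ ⟨a, haA⟩ := q.2.choose_spec
    obtain ⟨hq1, hq2⟩ := Prod.ext_iff.mp hq
    obtain ⟨u, t, ht0, hu⟩ := exists_units_mul_pow_eq_div (R := 𝓞 K) q.2.choose.2.1 ha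
      (hI _) (hI _) hq1 (by
        intro v
        by_cases hvS : v ∈ S
        · exact (ZMod.intCast_eq_intCast_iff _ _ _).mp (congrFun hq2 ⟨v, hvS⟩)
        · rw [Int.emod_eq_zero_of_dvd (q.2.choose.2.2 v hvS), Int.emod_eq_zero_of_dvd (haA.2 v hvS)])
    obtain ⟨w, hw⟩ := QuotientGroup.eq.mp
      (QuotientGroup.out_eq' (u : (𝓞 K)ˣ ⧸ (powMonoidHom d : (𝓞 K)ˣ →* _).range))
    refine ⟨_, ⟨(q, u), rfl⟩, algebraMap (𝓞 K) K w * t, mul_ne_zero (by simp) ht0, ?_⟩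
    rw [hu]
    have huw : (algebraMap (𝓞 K) K) u = algebraMap (𝓞 K) K
        ((u : (𝓞 K)ˣ ⧸ (powMonoidHom d : (𝓞 K)ˣ →* _).range).out : (𝓞 K)ˣ) *
          algebraMap (𝓞 K) K w ^ d := by
      rw [← map_pow, ← map_mul, ← Units.val_pow_eq_pow_val, ← Units.val_mul]
      exact congrArg _ (congrArg _ (inv_mul_eq_iff_eq_mul.mp hw.symm))
    rw [huw]
    ring


/-! ### Good reduction and integral coordinates -/

theorem finite_setOf_valuation_ne_one {R : Type*} [CommRing R] [IsDedekindDomain R] {K : Type*}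
    [Field K] [Algebra R K] [IsFractionRing R K] {a : K} (ha : a ≠ 0) :
    {v : HeightOneSpectrum R | v.valuation K a ≠ 1}.Finite := by
  refine (FractionalIdeal.finite_factors (FractionalIdeal.spanSingleton R⁰ a)).subset ?_
  intro v hv h
  apply hv
  rw [Set.mem_ofPred] at h
  rw [valuation_eq_exp_neg_count v ha, h, neg_zero, WithZero.exp_zero]

section Valuation

variable {K : Type*} [Field K] {Γ : Type*} [LinearOrderedCommGroupWithZero Γ]
  (w : Valuation K Γ)

theorem valuation_eval_le_one {p : Polynomial K} (hp : ∀ k, w (p.coeff k) ≤ 1) {x : K}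
    (hx : w x ≤ 1) : w (p.eval x) ≤ 1 := by
  rw [Polynomial.eval_eq_sum_range]
  refine w.map_sum_le fun k _ => ?_
  rw [map_mul, map_pow]
  exact mul_le_one' (hp k) (pow_le_one' hx k)

/-- Every monomial except the pure power of the first variable contains `s`, so modulo the maximal
ideal only the coefficient of degree `n` survives. -/
theorem valuation_eval_homogenize_sub_lt_one {p : Polynomial K} (hp : ∀ k, w (p.coeff k) ≤ 1)
    (n : ℕ) {s : K} (hs : w s < 1) :
    w (MvPolynomial.eval ![1, s] (p.homogenize n) - p.coeff n) < 1 := by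
  have h0 : ((n, 0) : ℕ × ℕ) ∈ Finset.HasAntidiagonal.antidiagonal n := by simp
  rw [eval_homogenize_eq_sum, ← Finset.add_sum_erase _ _ h0]
  simp only [Matrix.cons_val_zero, Matrix.cons_val_one, one_pow, pow_zero, mul_one, one_mul,
    add_sub_cancel_left]
  refine w.map_sum_lt one_ne_zero ?_
  rintro ⟨k, l⟩ hkl
  have hl : l ≠ 0 := by
    rintro rfl
    obtain ⟨h1, h2⟩ := Finset.mem_erase.mp hkl
    exact h1 (by simpa using h2)
  rw [map_mul, map_pow]
  exact (mul_le_of_le_one_left' (hp k)).trans_lt (pow_lt_one₀ zero_le hs hl)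

/-- Good reduction: where `[p : q]` has good reduction and takes an integral value, the
denominator has the largest possible absolute value. -/
theorem valuation_eval_homogenize_eq {p q a b : Polynomial K} {n : ℕ} (hpn : p.natDegree ≤ n)
    (hqn : q.natDegree ≤ n) (hab : a * p + b * q = 1)
    (hp : ∀ k, w (p.coeff k) ≤ 1) (hq : ∀ k, w (q.coeff k) ≤ 1)
    (ha : ∀ k, w (a.coeff k) ≤ 1) (hb : ∀ k, w (b.coeff k) ≤ 1)
    (hlead : w (q.coeff n) = 1 ∨ (q.coeff n = 0 ∧ w (p.coeff n) = 1))
    {x : Fin 2 → K} (hx : x ≠ 0)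
    (hle : w (MvPolynomial.eval x (p.homogenize n)) ≤ w (MvPolynomial.eval x (q.homogenize n))) :
    w (MvPolynomial.eval x (q.homogenize n)) = max (w (x 0)) (w (x 1)) ^ n := by
  rcases le_or_gt (w (x 0)) (w (x 1)) with h | h
  · have h1 : x 1 ≠ 0 := by
      intro h1
      rw [h1, map_zero, le_zero_iff, map_eq_zero] at h
      apply hx
      ext i
      fin_cases i <;> simp [h, h1]
    have hw1 : 0 < w (x 1) := by simpa [zero_lt_iff] using h1
    have ht : w (x 0 / x 1) ≤ 1 := by
      rw [map_div₀]; exact div_le_one_of_le₀ h zero_le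
    rw [Polynomial.eval_homogenize hpn _ h1, Polynomial.eval_homogenize hqn _ h1, map_mul, map_mul,
      map_pow] at hle
    rw [Polynomial.eval_homogenize hqn _ h1, max_eq_right h, map_mul, map_pow]
    have hle' : w (p.eval (x 0 / x 1)) ≤ w (q.eval (x 0 / x 1)) :=
      le_of_mul_le_mul_right hle (pow_pos hw1 n)
    have hq1 := valuation_eval_le_one w hq ht
    -- At an integral point of the affine chart the Bézout identity prevents `p` and `q` from both
    -- being small; since `p` is no larger than `q`, it is `q` that is a unit.
    have hbez := congrArg (fun f => w (f.eval (x 0 / x 1))) hab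
    simp only [Polynomial.eval_add, Polynomial.eval_mul, Polynomial.eval_one, map_one] at hbez
    have : 1 ≤ w (q.eval (x 0 / x 1)) := by
      rw [← hbez]
      refine (w.map_add _ _).trans (max_le ?_ ?_)
      · rw [map_mul]
        exact (mul_le_of_le_one_left' (valuation_eval_le_one w ha ht)).trans hle'
      · rw [map_mul]
        exact mul_le_of_le_one_left' (valuation_eval_le_one w hb ht)
    rw [le_antisymm hq1 this, one_mul]
  · have h0 : x 0 ≠ 0 := by
      intro h0
      rw [h0, map_zero] at h
      exact not_lt_zero h
    have hs : w (x 1 / x 0) < 1 := by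
      rw [map_div₀]; exact (div_lt_one₀ (zero_le.trans_lt h)).mpr h
    have hxs : x = x 0 • ![1, x 1 / x 0] := by
      ext i
      fin_cases i
      · simp
      · simp [mul_div_cancel₀ _ h0]
    have hP := valuation_eval_homogenize_sub_lt_one w hp n hs
    have hQ := valuation_eval_homogenize_sub_lt_one w hq n hs
    rw [max_eq_left h.le]
    generalize x 0 = c at *
    rw [hxs, eval_homogenize_smul, eval_homogenize_smul, map_mul, map_mul, map_pow] at hle
    rw [hxs, eval_homogenize_smul, map_mul, map_pow]
    have hle' := le_of_mul_le_mul_left hle (pow_pos (by simpa [zero_lt_iff] using h0) n)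
    -- Here the point reduces to `[1 : 0]`, where the forms reduce to their coefficients of degree
    -- `n`. If that of `q` vanishes, then `|q| < 1 = |p|`, against `hle`.
    rcases hlead with h2 | ⟨h2, h3⟩
    · rw [← h2] at hQ
      rw [w.map_eq_of_sub_lt hQ, h2, mul_one]
    · rw [h2, sub_zero] at hQ
      rw [← h3] at hP
      rw [w.map_eq_of_sub_lt hP, h3] at hle'
      exact absurd hle' (not_le.mpr hQ)

end Valuation

theorem exists_finite_valuation_coeff_eq_one {R : Type*} [CommRing R] [IsDedekindDomain R]
    {K : Type*} [Field K] [Algebra R K] [IsFractionRing R K] (p : Polynomial K) :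
    ∃ S : Set (HeightOneSpectrum R), S.Finite ∧
      ∀ v ∉ S, ∀ k, p.coeff k = 0 ∨ v.valuation K (p.coeff k) = 1 := by
  refine ⟨⋃ k ∈ p.support, {v | v.valuation K (p.coeff k) ≠ 1},
    p.support.finite_toSet.biUnion fun k hk =>
      finite_setOf_valuation_ne_one (Polynomial.mem_support_iff.mp hk), fun v hv k => ?_⟩
  by_contra! h
  exact hv (Set.mem_biUnion (Polynomial.mem_support_iff.mpr h.1) h.2)

theorem mapP1_mk_eq_affinePoint {K : Type*} [Field K] {f : RatFunc K} {v : Fin 2 → K} {hv : v ≠ 0}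
    {x : K} (h : mapP1 f (Projectivization.mk K v hv) = affinePoint x) :
    forms f v 1 ≠ 0 ∧ forms f v 0 = x * forms f v 1 := by
  obtain ⟨t, ht⟩ := (Projectivization.mk_eq_mk_iff _ _ _ (forms_ne_zero f hv) _).mp h
  have h0 := congrFun ht 0
  have h1 := congrFun ht 1
  simp only [Pi.smul_apply, Units.smul_def, Matrix.cons_val_zero, Matrix.cons_val_one, smul_eq_mul,
    mul_one] at h0 h1
  rw [← h0, ← h1]
  exact ⟨t.ne_zero, mul_comm _ _⟩

theorem max_natDegree_pos {K : Type*} [Field K] {f : RatFunc K} (hf : ∀ c : K, f ≠ RatFunc.C c) :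
    0 < max f.num.natDegree f.denom.natDegree := by
  by_contra! h
  obtain ⟨hn, hd⟩ := max_le_iff.mp h
  have hd1 : f.denom = 1 := f.monic_denom.natDegree_eq_zero.mp (Nat.le_zero.mp hd)
  refine hf (f.num.coeff 0) ?_
  conv_lhs => rw [← RatFunc.num_div_denom f, hd1, map_one, div_one,
    Polynomial.eq_C_of_natDegree_eq_zero (Nat.le_zero.mp hn)]
  exact RatFunc.algebraMap_C _

/-- The points of `T(f, S)` have `S'`-integral coordinates at which the denominator takes one of
finitely many nonzero values. -/
theorem exists_integral_representatives {K : Type*} [Field K] [NumberField K] (f : RatFunc K)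
    (hf : ∀ c : K, f ≠ RatFunc.C c) {S : Set (HeightOneSpectrum (𝓞 K))} (hS : S.Finite) :
    ∃ (S' : Set (HeightOneSpectrum (𝓞 K))) (C : Set K), S'.Finite ∧ C.Finite ∧ 0 ∉ C ∧
      ∀ P ∈ integralPreimage f S, ∃ (x : Fin 2 → K) (hx : x ≠ 0), P = Projectivization.mk K x hx ∧
        forms f x 1 ∈ C ∧ ∀ v ∉ S', ∀ i, v.valuation K (x i) ≤ 1 := by
  have hd := max_natDegree_pos hf
  obtain ⟨a, b, hab⟩ := f.isCoprime_num_denom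
  obtain ⟨Sn, hSn, hn⟩ := exists_finite_valuation_coeff_eq_one (R := 𝓞 K) f.num
  obtain ⟨Sd, hSd, hdn⟩ := exists_finite_valuation_coeff_eq_one (R := 𝓞 K) f.denom
  obtain ⟨Sa, hSa, ha⟩ := exists_finite_valuation_coeff_eq_one (R := 𝓞 K) a
  obtain ⟨Sb, hSb, hb⟩ := exists_finite_valuation_coeff_eq_one (R := 𝓞 K) b
  have hS₁ : (S ∪ (Sn ∪ Sd ∪ (Sa ∪ Sb))).Finite := hS.union ((hSn.union hSd).union (hSa.union hSb))
  obtain ⟨C, hC, hC0, hrep⟩ := exists_finite_representatives_mod_pow hS₁ hd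
  have hle : ∀ {v : HeightOneSpectrum (𝓞 K)} {p : Polynomial K},
      (∀ k, p.coeff k = 0 ∨ v.valuation K (p.coeff k) = 1) → ∀ k, v.valuation K (p.coeff k) ≤ 1 := by
    intro v p h k
    rcases h k with h | h <;> simp [h]
  have hkey : ∀ v ∉ S ∪ (Sn ∪ Sd ∪ (Sa ∪ Sb)), ∀ x : Fin 2 → K, x ≠ 0 → ∀ t ∈ S.integer K,
      forms f x 0 = t * forms f x 1 → v.valuation K (forms f x 1) =
        max (v.valuation K (x 0)) (v.valuation K (x 1)) ^
          max f.num.natDegree f.denom.natDegree := by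
    intro v hv x hx t ht hft
    simp only [Set.mem_union, not_or] at hv
    obtain ⟨hvS, ⟨hvn, hvd⟩, hva, hvb⟩ := hv
    refine valuation_eval_homogenize_eq (v.valuation K) (le_max_left _ _) (le_max_right _ _) hab
      (hle (hn v hvn)) (hle (hdn v hvd)) (hle (ha v hva)) (hle (hb v hvb)) ?_ hx ?_
    · rcases hdn v hvd (max f.num.natDegree f.denom.natDegree) with h | h
      · refine Or.inr ⟨h, (hn v hvn _).resolve_left fun h' => ?_⟩
        -- The two coefficients of degree `d` are the values of the forms at `[1 : 0]`, so they do
        -- not both vanish.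
        have := forms_ne_zero f (v := ![1, 0]) (by simp)
        apply this
        ext i
        fin_cases i <;> simp [forms, eval_homogenize_of_eq_zero, h, h']
      · exact Or.inl h
    · have := congrArg (v.valuation K) hft
      rw [map_mul] at this
      exact this.le.trans (mul_le_of_le_one_left' (ht v hvS))
  -- The places where some `c ∈ C` is not a unit are added: elsewhere `|c| = 1` forces the rescaled
  -- coordinates to have maximum exactly `1`.
  refine ⟨S ∪ (Sn ∪ Sd ∪ (Sa ∪ Sb)) ∪ ⋃ c ∈ C, {v | v.valuation K c ≠ 1}, C,
    hS₁.union (hC.biUnion fun c hc => finite_setOf_valuation_ne_one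
      (by rintro rfl; exact hC0 hc)), hC, hC0, fun P hP => ?_⟩
  obtain ⟨t, ht, htP⟩ := hP
  induction P using Projectivization.ind with | h x hx =>
  obtain ⟨hG, hFG⟩ := mapP1_mk_eq_affinePoint htP
  obtain ⟨c, hc, w, hw, hcw⟩ := hrep (forms f x 1) hG (by
    intro v hv
    refine (max_choice (v.valuation K (x 0)) (v.valuation K (x 1))).elim
      (fun h => ⟨x 0, ?_⟩) (fun h => ⟨x 1, ?_⟩) <;> rw [hkey v hv x hx t ht hFG, h])
  have hwx : w⁻¹ • x ≠ 0 := smul_ne_zero (inv_ne_zero hw) hx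
  have hGw : forms f (w⁻¹ • x) 1 = c := by
    rw [forms_smul, Pi.smul_apply, smul_eq_mul, hcw, inv_pow]
    field_simp
  refine ⟨w⁻¹ • x, hwx, ?_, by rwa [hGw], fun v hv => ?_⟩
  · exact (Projectivization.mk_eq_mk_iff' _ _ _ _ _).mpr ⟨w, by rw [smul_inv_smul₀ hw]⟩
  · rw [Set.mem_union, not_or] at hv
    have h1 : v.valuation K c = 1 := by
      by_contra h
      exact hv.2 (Set.mem_biUnion hc h)
    have h2 := hkey v hv.1 (w⁻¹ • x) hwx t ht (by
      rw [forms_smul, Pi.smul_apply, Pi.smul_apply, hFG, smul_eq_mul, smul_eq_mul]; ring)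
    rw [hGw, h1] at h2
    have h3 := (pow_eq_one_iff_of_nonneg zero_le hd.ne').mp h2.symm
    intro i
    rw [← h3]
    fin_cases i
    · exact le_max_left _ _
    · exact le_max_right _ _


/-! ### Counting `S`-integers of bounded height -/

theorem exists_real_cells {R : ℝ} (hR : 0 < R) {m : ℕ} (hm : 0 < m) :
    ∃ g : ℝ → Fin (2 * m + 1), ∀ x y : ℝ, |x| ≤ R → |y| ≤ R → g x = g y → |x - y| ≤ R / m := by
  have hm' : (0 : ℝ) < m := by exact_mod_cast hm
  -- For `|x| ≤ R` the floor lies in `[-m, m]`; after the shift by `m` the reduction modulo `2 * m +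
  -- 1` in `Fin.ofNat` changes nothing.
  refine ⟨fun x => Fin.ofNat (2 * m + 1) (⌊x * m / R⌋ + m).toNat, fun x y hx hy hxy => ?_⟩
  have hb : ∀ x : ℝ, |x| ≤ R → -(m : ℤ) ≤ ⌊x * m / R⌋ ∧ ⌊x * m / R⌋ ≤ m := by
    intro x hx
    obtain ⟨h1, h2⟩ := abs_le.mp hx
    constructor
    · rw [Int.le_floor, le_div_iff₀ hR]; push_cast; nlinarith
    · have : ((⌊x * m / R⌋ : ℤ) : ℝ) ≤ ((m : ℤ) : ℝ) := by
        refine (Int.floor_le _).trans ?_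
        rw [div_le_iff₀ hR]; push_cast; nlinarith
      exact_mod_cast this
  have hfl : ⌊x * m / R⌋ = ⌊y * m / R⌋ := by
    have h := congrArg Fin.val hxy
    simp only [Fin.ofNat] at h
    have h1 := hb x hx
    have h2 := hb y hy
    rw [Nat.mod_eq_of_lt (by omega), Nat.mod_eq_of_lt (by omega)] at h
    omega
  have := Int.abs_sub_lt_one_of_floor_eq_floor hfl
  rw [← sub_div, ← sub_mul, abs_div, abs_mul, abs_of_pos hR, abs_of_pos hm', div_lt_one hR] at this
  exact (le_div_iff₀ hm').mpr this.le

/-- At a complex place the real and imaginary parts are sorted separately, which squares the number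
of cells and costs the factor `2`. -/
theorem exists_cells {K : Type*} [Field K] (w : InfinitePlace K) {R : ℝ} (hR : 0 < R) {m : ℕ}
    (hm : 0 < m) :
    ∃ g : K → Fin ((2 * m + 1) ^ w.mult), ∀ x y : K, w x ≤ R → w y ≤ R → g x = g y →
      w (x - y) ≤ 2 * R / m := by
  obtain ⟨g, hg⟩ := exists_real_cells hR hm
  have hRm : 0 ≤ R / m := by positivity
  by_cases hw : w.IsReal
  · rw [InfinitePlace.mult, if_pos hw, pow_one]
    have hnorm : ∀ x : K, w x = |InfinitePlace.embedding_of_isReal hw x| := fun x => by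
      rw [← Real.norm_eq_abs, InfinitePlace.norm_embedding_of_isReal]
    refine ⟨fun x => g (InfinitePlace.embedding_of_isReal hw x), fun x y hx hy hxy => ?_⟩
    rw [hnorm] at hx hy ⊢
    rw [map_sub]
    have := hg _ _ hx hy hxy
    rw [mul_div_assoc]
    linarith
  · rw [InfinitePlace.mult, if_neg hw]
    let e : Fin (2 * m + 1) × Fin (2 * m + 1) ≃ Fin ((2 * m + 1) ^ 2) :=
      Fintype.equivFinOfCardEq (by simp [pow_two])
    have hnorm : ∀ x : K, w x = ‖w.embedding x‖ := fun x =>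
      (InfinitePlace.norm_embedding_eq w x).symm
    refine ⟨fun x => e (g (w.embedding x).re, g (w.embedding x).im), fun x y hx hy hxy => ?_⟩
    rw [hnorm] at hx hy ⊢
    obtain ⟨h1, h2⟩ := Prod.ext_iff.mp (e.injective hxy)
    have h1 := hg _ _ ((Complex.abs_re_le_norm _).trans hx) ((Complex.abs_re_le_norm _).trans hy) h1
    have h2 := hg _ _ ((Complex.abs_im_le_norm _).trans hx) ((Complex.abs_im_le_norm _).trans hy) h2
    have := Complex.norm_le_abs_re_add_abs_im (w.embedding (x - y))
    rw [map_sub, Complex.sub_re, Complex.sub_im] at this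
    rw [map_sub, mul_div_assoc]
    linarith

theorem le_prod_of_one_le {ι : Type*} {s : Finset ι} {f : ι → ℝ} (hf : ∀ i ∈ s, 1 ≤ f i) {i : ι}
    (hi : i ∈ s) : f i ≤ ∏ j ∈ s, f j := by
  classical
  rw [← Finset.mul_prod_erase s f hi]
  refine le_mul_of_one_le_right (zero_le_one.trans (hf i hi)) ?_
  exact Finset.one_le_prod fun j hj => hf j (Finset.mem_of_mem_erase hj)

section Count

variable {K : Type*} [Field K] [NumberField K]

theorem mulHeight₁_eq_of_integral {T : Finset (FinitePlace K)} {z : K}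
    (hz : ∀ v ∉ T, v z ≤ 1) :
    Height.mulHeight₁ z =
      (∏ v : InfinitePlace K, max (v z) 1 ^ v.mult) * ∏ v ∈ T, max (v z) 1 := by
  rw [NumberField.mulHeight₁_eq, finprod_eq_prod_of_mulSupport_subset]
  intro v hv
  by_contra h
  exact hv (max_eq_right (hz v h))

theorem max_infinitePlace_le_mulHeight₁ (w : InfinitePlace K) {T : Finset (FinitePlace K)} {z : K}
    (hz : ∀ v ∉ T, v z ≤ 1) : max (w z) 1 ≤ Height.mulHeight₁ z := by
  rw [mulHeight₁_eq_of_integral hz]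
  have h1 : ∀ v : InfinitePlace K, 1 ≤ max (v z) 1 ^ v.mult := fun v =>
    one_le_pow₀ (le_max_right _ _)
  calc max (w z) 1 ≤ max (w z) 1 ^ w.mult :=
        le_self_pow₀ (le_max_right _ _) w.mult_ne_zero
    _ ≤ ∏ v : InfinitePlace K, max (v z) 1 ^ v.mult :=
        le_prod_of_one_le (f := fun v : InfinitePlace K => max (v z) 1 ^ v.mult)
          (fun v _ => h1 v) (Finset.mem_univ w)
    _ ≤ _ := le_mul_of_one_le_right (Finset.prod_nonneg fun v _ => zero_le_one.trans (h1 v))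
        (Finset.one_le_prod fun v _ => le_max_right _ _)

theorem max_finitePlace_le_mulHeight₁ {T : Finset (FinitePlace K)} {w : FinitePlace K} (hw : w ∈ T)
    {z : K} (hz : ∀ v ∉ T, v z ≤ 1) : max (w z) 1 ≤ Height.mulHeight₁ z := by
  rw [mulHeight₁_eq_of_integral hz]
  calc max (w z) 1 ≤ ∏ v ∈ T, max (v z) 1 :=
        le_prod_of_one_le (f := fun v : FinitePlace K => max (v z) 1)
          (fun v _ => le_max_right _ _) hw
    _ ≤ _ := le_mul_of_one_le_left
        (Finset.prod_nonneg fun v _ => zero_le_one.trans (le_max_right _ _))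
        (Finset.one_le_prod fun v _ => one_le_pow₀ (le_max_right _ _))

/-- The product formula, as a lower bound for the absolute values at the places of a finite set. -/
theorem one_le_prod_of_integral {T : Finset (FinitePlace K)} {z : K} (hz0 : z ≠ 0)
    (hz : ∀ v ∉ T, v z ≤ 1) :
    1 ≤ (∏ v : InfinitePlace K, v z ^ v.mult) * ∏ v ∈ T, v z := by
  classical
  rw [← NumberField.prod_abs_eq_one hz0]
  have hfin : (Function.mulSupport fun v : FinitePlace K => v z).Finite :=
    FinitePlace.hasFiniteMulSupport hz0
  rw [finprod_eq_prod_of_mulSupport_subset (s := hfin.toFinset ∪ T) _ (by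
    intro v hv
    rw [Finset.coe_union, Set.Finite.coe_toFinset]
    exact Or.inl hv), ← Finset.prod_sdiff (Finset.subset_union_right (s₂ := T))]
  refine mul_le_mul_of_nonneg_left ?_ (Finset.prod_nonneg fun v _ => by positivity)
  refine mul_le_of_le_one_left (Finset.prod_nonneg fun v _ => by positivity) ?_
  exact Finset.prod_le_one (fun v _ => by positivity) fun v hv => hz v (Finset.mem_sdiff.mp hv).2

theorem le_two_pow_ceil_logb {t : ℝ} (ht : 1 ≤ t) : t ≤ 2 ^ ⌈Real.logb 2 t⌉₊ := by
  have h := Nat.le_ceil (Real.logb 2 t)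
  rwa [Real.logb_le_iff_le_rpow one_lt_two (by linarith), Real.rpow_natCast] at h

theorem two_pow_ceil_logb_le {t : ℝ} (ht : 1 ≤ t) : (2 : ℝ) ^ ⌈Real.logb 2 t⌉₊ ≤ 2 * t := by
  have h := (Nat.ceil_lt_add_one (Real.logb_nonneg one_lt_two ht)).le
  rw [← Real.logb_self_eq_one one_lt_two (b := 2),
    ← Real.logb_mul (by linarith) two_ne_zero,
    Real.le_logb_iff_rpow_le one_lt_two (by linarith), Real.rpow_natCast] at h
  linarith

/-- The `S`-integers of bounded height, sorted by the sizes of their absolute values and then by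
small cells, are separated by the product formula. -/
theorem ncard_integral_le (T : Finset (FinitePlace K)) {X : ℝ} {m : ℕ} (hm : 0 < m)
    (hX : 4 ^ Module.finrank ℚ K * 2 ^ T.card * X < (m : ℝ) ^ Module.finrank ℚ K) :
    {z : K | (∀ v ∉ T, v z ≤ 1) ∧ Height.mulHeight₁ z ≤ X}.ncard ≤
      (⌈Real.logb 2 X⌉₊ + 1) ^ (Fintype.card (InfinitePlace K) + T.card) *
        (2 * m + 1) ^ Module.finrank ℚ K := by
  classical
  set Z := {z : K | (∀ v ∉ T, v z ≤ 1) ∧ Height.mulHeight₁ z ≤ X} with hZ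
  have hm' : (0 : ℝ) < m := by exact_mod_cast hm
  choose g hg using fun (w : InfinitePlace K) (k : ℕ) =>
    exists_cells w (R := 2 ^ k) (by positivity) hm
  let kk : ℝ → Fin (⌈Real.logb 2 X⌉₊ + 1) := fun t => Fin.ofNat _ ⌈Real.logb 2 (max t 1)⌉₊
  have hkk : ∀ s t : ℝ, max s 1 ≤ X → max t 1 ≤ X → kk s = kk t →
      ⌈Real.logb 2 (max s 1)⌉₊ = ⌈Real.logb 2 (max t 1)⌉₊ := by
    have hlt : ∀ s : ℝ, max s 1 ≤ X → ⌈Real.logb 2 (max s 1)⌉₊ < ⌈Real.logb 2 X⌉₊ + 1 :=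
      fun s hs => Nat.lt_succ_of_le <| Nat.ceil_le_ceil <|
        Real.logb_le_logb_of_le one_lt_two (zero_lt_one.trans_le (le_max_right _ _)) hs
    intro s t hs ht h
    have h := congrArg Fin.val h
    simp only [kk, Fin.ofNat] at h
    rwa [Nat.mod_eq_of_lt (hlt s hs), Nat.mod_eq_of_lt (hlt t ht)] at h
  -- Dyadic sizes at the infinite places and at `T`, then the cell at each infinite place within the
  -- box of that dyadic size.
  let Φ : K → ((InfinitePlace K → Fin (⌈Real.logb 2 X⌉₊ + 1)) ×
      (T → Fin (⌈Real.logb 2 X⌉₊ + 1))) × (∀ w : InfinitePlace K, Fin ((2 * m + 1) ^ w.mult)) :=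
    fun z => ((fun w => kk (w z), fun v => kk (v.1 z)),
      fun w => g w ⌈Real.logb 2 (max (w z) 1)⌉₊ z)
  have hinj : Set.InjOn Φ Z := by
    rintro x ⟨hx, hxX⟩ y ⟨hy, hyX⟩ hxy
    obtain ⟨hxy1, hcell⟩ := Prod.ext_iff.mp hxy
    obtain ⟨hinf, hfin⟩ := Prod.ext_iff.mp hxy1
    have hinf' : ∀ w : InfinitePlace K,
        ⌈Real.logb 2 (max (w x) 1)⌉₊ = ⌈Real.logb 2 (max (w y) 1)⌉₊ := fun w =>
      hkk _ _ ((max_infinitePlace_le_mulHeight₁ w hx).trans hxX)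
        ((max_infinitePlace_le_mulHeight₁ w hy).trans hyX) (congrFun hinf w)
    have hfin' : ∀ v ∈ T, ⌈Real.logb 2 (max (v x) 1)⌉₊ = ⌈Real.logb 2 (max (v y) 1)⌉₊ :=
      fun v hv => hkk _ _ ((max_finitePlace_le_mulHeight₁ hv hx).trans hxX)
        ((max_finitePlace_le_mulHeight₁ hv hy).trans hyX) (congrFun hfin ⟨v, hv⟩)
    by_contra hne
    have hsub : ∀ (v : FinitePlace K), v (x - y) ≤ max (v x) (v y) := fun v => by
      rw [sub_eq_add_neg]
      exact (FinitePlace.add_le v _ _).trans (by rw [map_neg_eq_map])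
    -- If `x ≠ y` share all data, then `|x - y| ≤ (4 / m) max(|x|, 1)` at infinite places (radius at
    -- most `2 max(|x|, 1)`, cells of size `2 / m` times the radius) and `|x - y| ≤ 2 max(|x|, 1)`
    -- on `T`. The product is at most `(4 / m) ^ n * 2 ^ |T| * H(x) < 1`, contradicting this bound.
    have hone := one_le_prod_of_integral (T := T) (sub_ne_zero.mpr hne)
      fun v hv => (hsub v).trans (max_le (hx v hv) (hy v hv))
    have hle1 : ∏ v : InfinitePlace K, v (x - y) ^ v.mult ≤
        (4 / m) ^ Module.finrank ℚ K * ∏ v : InfinitePlace K, max (v x) 1 ^ v.mult := by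
      rw [← InfinitePlace.sum_mult_eq, ← Finset.prod_pow_eq_pow_sum, ← Finset.prod_mul_distrib]
      refine Finset.prod_le_prod (fun v _ => by positivity) fun v _ => ?_
      rw [← mul_pow]
      refine pow_le_pow_left₀ (by positivity) ?_ _
      have h1 := hg v ⌈Real.logb 2 (max (v x) 1)⌉₊ x y
        ((le_max_left _ _).trans (le_two_pow_ceil_logb (le_max_right _ _)))
        ((le_max_left _ _).trans
          ((le_two_pow_ceil_logb (le_max_right _ _)).trans_eq (by rw [hinf' v])))
        ((congrFun hcell v).trans (congrArg (fun k => g v k y) (hinf' v).symm))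
      refine h1.trans ?_
      have h2 := two_pow_ceil_logb_le (le_max_right (v x) 1)
      rw [div_mul_eq_mul_div]
      exact div_le_div_of_nonneg_right (by linarith) hm'.le
    have hle2 : ∏ v ∈ T, v (x - y) ≤ 2 ^ T.card * ∏ v ∈ T, max (v x) 1 := by
      rw [← Finset.prod_const, ← Finset.prod_mul_distrib]
      refine Finset.prod_le_prod (fun v _ => by positivity) fun v hv => ?_
      refine (hsub v).trans (le_trans ?_ (two_pow_ceil_logb_le (le_max_right (v x) 1)))
      refine max_le ((le_max_left _ _).trans (le_two_pow_ceil_logb (le_max_right _ _))) ?_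
      rw [hfin' v hv]
      exact (le_max_left _ _).trans (le_two_pow_ceil_logb (le_max_right _ _))
    have hcontra : (1 : ℝ) ≤ (4 / m) ^ Module.finrank ℚ K * 2 ^ T.card * X := by
      calc (1 : ℝ) ≤ _ := hone
        _ ≤ _ := mul_le_mul hle1 hle2 (Finset.prod_nonneg fun v _ => by positivity) (by positivity)
        _ = (4 / m) ^ Module.finrank ℚ K * 2 ^ T.card * Height.mulHeight₁ x := by
            rw [mulHeight₁_eq_of_integral hx]; ring
        _ ≤ _ := mul_le_mul_of_nonneg_left hxX (by positivity)
    rw [div_pow, div_mul_eq_mul_div, div_mul_eq_mul_div, le_div_iff₀ (by positivity), one_mul]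
      at hcontra
    exact absurd hX (not_lt.mpr hcontra)
  rw [← hinj.ncard_image]
  refine (Set.ncard_le_card _).trans ?_
  simp only [Nat.card_eq_fintype_card, Fintype.card_prod, Fintype.card_pi, Fintype.card_fin,
    Finset.prod_const, Finset.card_univ, Fintype.card_coe, Finset.prod_pow_eq_pow_sum,
    InfinitePlace.sum_mult_eq, pow_add]
  exact le_rfl

theorem exists_ncard_integral_le (T : Finset (FinitePlace K)) :
    ∃ (A : ℝ) (N : ℕ), 0 < A ∧ ∀ Y : ℝ, 1 ≤ Y →
      ({z : K | (∀ v ∉ T, v z ≤ 1) ∧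
        Height.mulHeight₁ z ≤ Y ^ Module.finrank ℚ K}.ncard : ℝ) ≤
          A * (Real.log Y + 1) ^ N * Y ^ Module.finrank ℚ K := by
  set n := Module.finrank ℚ K with hn
  have hn0 : 0 < n := Module.finrank_pos
  refine ⟨(2 * n + 2) ^ (Fintype.card (InfinitePlace K) + T.card) * (15 * 2 ^ T.card) ^ n,
    Fintype.card (InfinitePlace K) + T.card, by positivity, fun Y hY => ?_⟩
  -- Just large enough for the separation condition, so the cells number `O(Y ^ n)` and the dyadic
  -- patterns contribute only a power of `log Y + 1`.
  set m := ⌊4 * 2 ^ T.card * Y⌋₊ + 1 with hm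
  have hmlt : 4 * 2 ^ T.card * Y < (m : ℝ) := by
    rw [hm]; push_cast; exact Nat.lt_floor_add_one _
  have h2T : (1 : ℝ) ≤ 2 ^ T.card := one_le_pow₀ one_le_two
  have h2Y : 1 ≤ 2 ^ T.card * Y := one_le_mul_of_one_le_of_one_le h2T hY
  have hmle : (m : ℝ) ≤ 5 * 2 ^ T.card * Y := by
    have := Nat.floor_le (show 0 ≤ 4 * 2 ^ T.card * Y by positivity)
    rw [hm]; push_cast; linarith
  have hcount := ncard_integral_le T (X := Y ^ n) (m := m) (Nat.succ_pos _) (by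
    refine lt_of_le_of_lt ?_ (pow_lt_pow_left₀ hmlt (by positivity) hn0.ne')
    rw [mul_pow, mul_pow]
    gcongr
    exact le_self_pow₀ h2T hn0.ne')
  have hlog : 0 ≤ Real.log Y := Real.log_nonneg hY
  have hceil : (⌈Real.logb 2 (Y ^ n)⌉₊ + 1 : ℝ) ≤ (2 * n + 2) * (Real.log Y + 1) := by
    have h1 := (Nat.ceil_lt_add_one (Real.logb_nonneg one_lt_two (one_le_pow₀ hY (n := n)))).le
    have h2 : Real.logb 2 (Y ^ n) ≤ 2 * n * Real.log Y := by
      rw [Real.logb, Real.log_pow, div_le_iff₀ (Real.log_pos one_lt_two)]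
      have := Real.log_two_gt_d9
      have h3 : 0 ≤ n * Real.log Y := by positivity
      nlinarith
    have h3 : (0 : ℝ) ≤ n := Nat.cast_nonneg n
    nlinarith
  have hcount' : ({z : K | (∀ v ∉ T, v z ≤ 1) ∧ Height.mulHeight₁ z ≤ Y ^ n}.ncard : ℝ) ≤
      (⌈Real.logb 2 (Y ^ n)⌉₊ + 1 : ℝ) ^ (Fintype.card (InfinitePlace K) + T.card) *
        (2 * m + 1) ^ n := by
    exact_mod_cast hcount
  refine hcount'.trans ?_
  calc _ ≤ ((2 * n + 2) * (Real.log Y + 1)) ^ (Fintype.card (InfinitePlace K) + T.card) *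
        (15 * 2 ^ T.card * Y) ^ n := by
        gcongr
        have : (1 : ℝ) ≤ m := by exact_mod_cast Nat.succ_pos _
        linarith
    _ = _ := by rw [mul_pow, mul_pow]; ring

end Count


/-! ### A lower bound for the number of points of bounded height -/

/-- The coprime pairs of positive integers up to `M`. -/
def coprimePairs (M : ℕ) : Finset (ℕ × ℕ) :=
  (Finset.Ioc 0 M ×ˢ Finset.Ioc 0 M).filter fun p => p.1.Coprime p.2

theorem card_coprimePairs_ge (M : ℕ) : (M : ℝ) ^ 2 / 4 ≤ (coprimePairs M).card := by
  rcases Nat.lt_or_ge M 2 with hM | hM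
  · interval_cases M
    · simp
    · have : (coprimePairs 1).card = 1 := by decide
      rw [this]; norm_num
  have hcard := Finset.card_filter_add_card_filter_not (s := Finset.Ioc 0 M ×ˢ Finset.Ioc 0 M)
    (fun p => p.1.Coprime p.2)
  rw [Finset.card_product, Nat.card_Ioc, Nat.sub_zero] at hcard
  -- A union bound over the common divisor `d ≥ 2`.
  have hsub : (Finset.Ioc 0 M ×ˢ Finset.Ioc 0 M).filter (fun p => ¬ p.1.Coprime p.2) ⊆
      (Finset.Ioc 1 M).biUnion fun d =>
        (Finset.Ioc 0 M).filter (d ∣ ·) ×ˢ (Finset.Ioc 0 M).filter (d ∣ ·) := by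
    rintro ⟨a, b⟩ h
    simp only [Finset.mem_filter, Finset.mem_product, Finset.mem_Ioc] at h
    obtain ⟨⟨ha, hb⟩, hab⟩ := h
    simp only [Finset.mem_biUnion, Finset.mem_product, Finset.mem_filter, Finset.mem_Ioc]
    have hpos := Nat.gcd_pos_of_pos_left b ha.1
    refine ⟨a.gcd b, ⟨?_, (Nat.gcd_le_left b ha.1).trans ha.2⟩, ⟨ha, Nat.gcd_dvd_left a b⟩, hb,
      Nat.gcd_dvd_right a b⟩
    have : a.gcd b ≠ 1 := hab
    omega
  have hle := (Finset.card_le_card hsub).trans Finset.card_biUnion_le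
  simp only [Finset.card_product, Nat.Ioc_filter_dvd_card_eq_div] at hle
  have hle' : (((Finset.Ioc 0 M ×ˢ Finset.Ioc 0 M).filter
      (fun p => ¬ p.1.Coprime p.2)).card : ℝ) ≤ (M : ℝ) ^ 2 * (3 / 4) := by
    calc _ ≤ ((∑ d ∈ Finset.Ioc 1 M, M / d * (M / d) : ℕ) : ℝ) := by exact_mod_cast hle
      _ ≤ ∑ d ∈ Finset.Ioc 1 M, (M : ℝ) ^ 2 * ((d : ℝ) ^ 2)⁻¹ := by
          push_cast
          refine Finset.sum_le_sum fun d _ => ?_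
          have h := Nat.cast_div_le (α := ℝ) (m := M) (n := d)
          calc _ ≤ (M / d : ℝ) * (M / d) := mul_le_mul h h (Nat.cast_nonneg _) (by positivity)
            _ = _ := by rw [← div_eq_mul_inv, ← pow_two, div_pow]
      _ ≤ _ := by
          rw [← Finset.mul_sum]
          refine mul_le_mul_of_nonneg_left ?_ (by positivity)
          -- The term `d = 2` is split off: telescoping bounds the rest by `1/2`, for a total of
          -- `3/4`, whereas telescoping from `1` would only give a total below `1`.
          rw [← Finset.sum_Ioc_consecutive _ one_le_two hM]
          have := sum_Ioc_inv_sq_le_sub (α := ℝ) two_ne_zero hM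
          have h2 : (0 : ℝ) ≤ (M : ℝ)⁻¹ := by positivity
          have h3 : ∑ d ∈ Finset.Ioc (1 : ℕ) 2, ((d : ℝ) ^ 2)⁻¹ = 1 / 4 := by
            rw [show Finset.Ioc (1 : ℕ) 2 = {2} from rfl, Finset.sum_singleton]
            norm_num
          rw [h3]
          push_cast at this
          linarith
  have hcard' : ((coprimePairs M).card : ℝ) + (((Finset.Ioc 0 M ×ˢ Finset.Ioc 0 M).filter
      (fun p => ¬ p.1.Coprime p.2)).card : ℝ) = (M : ℝ) ^ 2 := by
    rw [pow_two]; exact_mod_cast hcard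
  linarith

theorem affinePoint_injective {K : Type*} [Field K] :
    Function.Injective (affinePoint : K → ℙ K (Fin 2 → K)) := by
  intro x y h
  obtain ⟨t, ht⟩ := (Projectivization.mk_eq_mk_iff' _ _ _ _ _).mp h
  have h0 := congrFun ht 0
  have h1 := congrFun ht 1
  simp at h0 h1
  rw [← h0, h1, one_mul]

section Lower

variable {K : Type*} [Field K] [NumberField K]

/-- For integral coordinates the finite part of the height is the inverse norm of the ideal they
generate, hence at most `1`. -/
theorem mulHeight₁_div_le {x y : 𝓞 K} (hy : y ≠ 0) {D : ℝ}
    (hxD : ∀ w : InfinitePlace K, w x ≤ D) (hyD : ∀ w : InfinitePlace K, w y ≤ D) :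
    Height.mulHeight₁ ((x : K) / y) ≤ D ^ Module.finrank ℚ K := by
  have hv : (![x, y] : Fin 2 → 𝓞 K) ≠ 0 := fun h => hy (by simpa using congrFun h 1)
  have hcoe : ![(x : K), (y : K)] = fun i => ((![x, y] : Fin 2 → 𝓞 K) i : K) := by
    ext i; fin_cases i <;> rfl
  have hvK : (fun i => ((![x, y] : Fin 2 → 𝓞 K) i : K)) ≠ 0 := by
    intro h
    have := congrFun h 1
    simp at this
    exact hy this
  have hfin := NumberField.absNorm_mul_finprod_finitePlace_eq_one hv
  rw [Height.mulHeight₁_div_eq_mulHeight, hcoe, NumberField.mulHeight_eq hvK]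
  have h0 : 0 ≤ ∏ᶠ v : FinitePlace K, ⨆ i, v ((![x, y] : Fin 2 → 𝓞 K) i : K) :=
    finprod_nonneg fun v => Real.iSup_nonneg fun i => by positivity
  have h1 : ∏ᶠ v : FinitePlace K, ⨆ i, v ((![x, y] : Fin 2 → 𝓞 K) i : K) ≤ 1 := by
    rw [← hfin]
    refine le_mul_of_one_le_left h0 ?_
    rw [Nat.one_le_cast, Nat.one_le_iff_ne_zero]
    intro h
    rw [h, Nat.cast_zero, zero_mul] at hfin
    exact zero_ne_one hfin
  have hsup : ∀ w : InfinitePlace K, ⨆ i, w ((![x, y] : Fin 2 → 𝓞 K) i : K) ≤ D := by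
    intro w
    refine ciSup_le fun i => ?_
    fin_cases i
    · exact hxD w
    · exact hyD w
  have hsup0 : ∀ w : InfinitePlace K, 0 ≤ ⨆ i, w ((![x, y] : Fin 2 → 𝓞 K) i : K) :=
    fun w => Real.iSup_nonneg fun i => by positivity
  calc _ ≤ _ := mul_le_of_le_one_right
        (Finset.prod_nonneg fun w _ => pow_nonneg (hsup0 w) _) h1
    _ ≤ ∏ w : InfinitePlace K, D ^ w.mult :=
        Finset.prod_le_prod (fun w _ => pow_nonneg (hsup0 w) _) fun w _ =>
          pow_le_pow_left₀ (hsup0 w) (hsup w) _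
    _ = _ := by rw [Finset.prod_pow_eq_pow_sum, InfinitePlace.sum_mult_eq]

theorem absHeight_le_iff {P : ℙ K (Fin 2 → K)} {B : ℝ} (hB : 0 ≤ B) :
    absHeight P ≤ B ↔ P.mulHeight ≤ B ^ Module.finrank ℚ K := by
  have hn : (0 : ℝ) < (Module.finrank ℚ K : ℝ) := Nat.cast_pos.mpr Module.finrank_pos
  have h0 : 0 ≤ P.mulHeight := by
    induction P using Projectivization.ind with | h v hv =>
    rw [Projectivization.mulHeight_mk]
    exact (Height.mulHeight_pos v).le
  rw [absHeight, Real.rpow_inv_le_iff_of_pos h0 hB hn, Real.rpow_natCast]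

/-- The points used are `α / b`, where `α` has positive integer coordinates up to `M ≍ B` in an
integral basis, `b` is a positive integer up to `M`, and one fixed coordinate of `α` is coprime to
`b`. These `n + 1` integer parameters give the exponent. -/
theorem exists_ncard_boundedHeight_univ_ge :
    ∃ c : ℝ, 0 < c ∧ ∃ B₀ : ℝ, ∀ B : ℝ, B₀ ≤ B → c * B ^ (Module.finrank ℚ K + 1) ≤
      ((boundedHeight (Set.univ : Set (ℙ K (Fin 2 → K))) B).ncard : ℝ) := by
  classical
  set n := Module.finrank ℚ K with hn
  have hn0 : 0 < n := Module.finrank_pos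
  let ω := RingOfIntegers.basis K
  have hcard : Fintype.card (Module.Free.ChooseBasisIndex ℤ (𝓞 K)) = n := by
    rw [← Module.finrank_eq_card_basis ω, RingOfIntegers.rank]
  obtain ⟨i₀⟩ : Nonempty (Module.Free.ChooseBasisIndex ℤ (𝓞 K)) :=
    Fintype.card_pos_iff.mp (hcard ▸ hn0)
  let D : ℝ := 1 + ∑ w : InfinitePlace K, ∑ i, w (ω i : K)
  have hsum0 : ∀ w : InfinitePlace K, 0 ≤ ∑ i, w (ω i : K) := fun w =>
    Finset.sum_nonneg fun i _ => by positivity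
  have hD1 : 1 ≤ D := le_add_of_nonneg_right (Finset.sum_nonneg fun w _ => hsum0 w)
  have hDw : ∀ w : InfinitePlace K, ∑ i, w (ω i : K) ≤ D := fun w =>
    (Finset.single_le_sum (f := fun w : InfinitePlace K => ∑ i, w (ω i : K))
      (fun w _ => hsum0 w) (Finset.mem_univ w)).trans (le_add_of_nonneg_left zero_le_one)
  have hD0 : 0 < D := zero_lt_one.trans_le hD1
  -- For `B ≥ 2 * D` rounding down loses at most half: `M ≥ B / (2 * D)`.
  refine ⟨(4 * (2 * D) ^ (n + 1))⁻¹, by positivity, 2 * D, fun B hB => ?_⟩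
  have hB0 : 0 < B := by linarith
  set M := ⌊B / D⌋₊ with hM
  have hMle : (M : ℝ) * D ≤ B := by
    have := Nat.floor_le (show 0 ≤ B / D by positivity)
    rwa [← hM, le_div_iff₀ hD0] at this
  have hMge : B ≤ M * (2 * D) := by
    have h1 := Nat.lt_floor_add_one (B / D)
    rw [← hM, div_lt_iff₀ hD0] at h1
    nlinarith
  let E := coprimePairs M ×ˢ
    Fintype.piFinset fun _ : {i // i ≠ i₀} => Finset.Ioc 0 M
  let coord : (ℕ × ℕ) × ({i // i ≠ i₀} → ℕ) → Module.Free.ChooseBasisIndex ℤ (𝓞 K) → ℤ :=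
    fun e i => if h : i = i₀ then e.1.1 else e.2 ⟨i, h⟩
  let α : (ℕ × ℕ) × ({i // i ≠ i₀} → ℕ) → 𝓞 K := fun e => ∑ i, coord e i • ω i
  let pt : (ℕ × ℕ) × ({i // i ≠ i₀} → ℕ) → ℙ K (Fin 2 → K) :=
    fun e => affinePoint ((α e : K) / ((e.1.2 : 𝓞 K) : K))
  have hmem : ∀ e ∈ E, (0 < e.1.1 ∧ e.1.1 ≤ M) ∧ (0 < e.1.2 ∧ e.1.2 ≤ M) ∧ e.1.1.Coprime e.1.2 ∧
      ∀ i, (0 < e.2 i ∧ e.2 i ≤ M) := by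
    intro e he
    simp only [E, coprimePairs, Finset.mem_product, Finset.mem_filter, Fintype.mem_piFinset,
      Finset.mem_Ioc] at he
    exact ⟨he.1.1.1, he.1.1.2, he.1.2, he.2⟩
  have hpt : ∀ e ∈ E, pt e ∈ (boundedHeight_finite (K := K) Set.univ B).toFinset := by
    intro e he
    obtain ⟨h1, h2, -, h3⟩ := hmem e he
    rw [Set.Finite.mem_toFinset]
    refine ⟨Set.mem_univ _, (absHeight_le_iff hB0.le).mpr ?_⟩
    simp only [pt, affinePoint]
    rw [Projectivization.mulHeight_mk, ← Height.mulHeight₁_eq_mulHeight]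
    refine mulHeight₁_div_le (by exact_mod_cast h2.1.ne') (fun w => ?_) fun w => ?_
    · have hc : ∀ i, w ((coord e i : ℤ) : K) ≤ M := by
        intro i
        by_cases h : i = i₀
        · simp only [coord, h, dif_pos]
          simpa using h1.2
        · simp only [coord, h, dif_neg, not_false_iff]
          simpa using (h3 ⟨i, h⟩).2
      refine le_trans ?_ hMle
      simp only [α, map_sum, zsmul_eq_mul, map_mul, map_intCast]
      calc _ ≤ ∑ i, w ((coord e i : ℤ) : K) * w (ω i : K) := by
            refine (w.1.sum_le _ _).trans (Finset.sum_le_sum fun i _ => ?_)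
            exact (map_mul w _ _).le
        _ ≤ ∑ i, M * w (ω i : K) := Finset.sum_le_sum fun i _ =>
            mul_le_mul_of_nonneg_right (hc i) (by positivity)
        _ ≤ _ := by
            rw [← Finset.mul_sum]
            exact mul_le_mul_of_nonneg_left (hDw w) (Nat.cast_nonneg M)
    · have : w (((e.1.2 : 𝓞 K) : K)) = e.1.2 := by simp
      rw [this]
      refine le_trans ?_ ((le_mul_of_one_le_right (Nat.cast_nonneg M) hD1).trans hMle)
      exact_mod_cast h2.2
  have hinj : Set.InjOn pt E := by
    intro e he e' he' hee
    obtain ⟨h1, h2, h3, -⟩ := hmem e he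
    obtain ⟨h1', h2', h3', -⟩ := hmem e' he'
    have h := affinePoint_injective hee
    have hb : ((e.1.2 : 𝓞 K) : K) ≠ 0 := by simpa using h2.1.ne'
    have hb' : ((e'.1.2 : 𝓞 K) : K) ≠ 0 := by simpa using h2'.1.ne'
    rw [div_eq_div_iff hb hb'] at h
    have h' : (e'.1.2 : ℤ) • α e = (e.1.2 : ℤ) • α e' := by
      apply RingOfIntegers.coe_injective
      simp only [zsmul_eq_mul, Int.cast_natCast, map_mul, map_natCast] at h ⊢
      rw [mul_comm, h, mul_comm]
    have hcoord : ∀ i, (e'.1.2 : ℤ) * coord e i = e.1.2 * coord e' i := by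
      intro i
      have := congrArg (fun z => ω.repr z i) h'
      simp only [map_smul, Finsupp.smul_apply, smul_eq_mul] at this
      rwa [ω.repr_sum_self, ω.repr_sum_self] at this
    have h0 := hcoord i₀
    simp only [coord, dif_pos] at h0
    have h0' : e'.1.2 * e.1.1 = e.1.2 * e'.1.1 := by exact_mod_cast h0
    -- At `i₀` both fractions are in lowest terms, so the denominators agree; then so do all
    -- coordinates.
    have hbb : e.1.2 = e'.1.2 := Nat.dvd_antisymm
      (h3.symm.dvd_of_dvd_mul_right (Dvd.intro _ h0'.symm))
      (h3'.symm.dvd_of_dvd_mul_right (Dvd.intro _ h0'))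
    have haa : ∀ i, coord e i = coord e' i := by
      intro i
      have := hcoord i
      rw [hbb] at this
      exact mul_left_cancel₀ (by exact_mod_cast h2'.1.ne') this
    refine Prod.ext (Prod.ext ?_ hbb) ?_
    · have := haa i₀
      simp only [coord, dif_pos] at this
      exact_mod_cast this
    · ext ⟨i, hi⟩
      have := haa i
      simp only [coord, hi, dif_neg, not_false_iff] at this
      exact_mod_cast this
  have hEcard : E.card = (coprimePairs M).card * M ^ (n - 1) := by
    rw [Finset.card_product, Fintype.card_piFinset]
    simp [hcard]
  have hle : E.card ≤ (boundedHeight (Set.univ : Set (ℙ K (Fin 2 → K))) B).ncard := by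
    rw [Set.ncard_eq_toFinset_card _ (boundedHeight_finite _ B)]
    exact Finset.card_le_card_of_injOn pt hpt hinj
  calc (4 * (2 * D) ^ (n + 1))⁻¹ * B ^ (n + 1)
      ≤ (4 * (2 * D) ^ (n + 1))⁻¹ * (M * (2 * D)) ^ (n + 1) := by gcongr
    _ = (M : ℝ) ^ 2 / 4 * M ^ (n - 1) := by
        have h : (M : ℝ) ^ (n + 1) = M ^ 2 * M ^ (n - 1) := by
          rw [← pow_add]; congr 1; omega
        rw [mul_pow (M : ℝ), h]
        field_simp
    _ ≤ ((coprimePairs M).card : ℝ) * M ^ (n - 1) := by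
        gcongr
        exact card_coprimePairs_ge M
    _ ≤ _ := by exact_mod_cast hEcard ▸ hle

end Lower


/-! ### Points on the curves `G = c`, and the density -/

open Filter Topology

/-- If the denominator is constant, `G` is the `d`-th power of the second coordinate, so the first
one must be fixed. Otherwise the second is fixed, and `G = c` is a nontrivial equation for the
first; when `z = 0` it is nontrivial because `c ≠ 0`. -/
theorem exists_fibre_polynomial {K : Type*} [Field K] (f : RatFunc K)
    (hf : ∀ c : K, f ≠ RatFunc.C c) {c : K} (hc : c ≠ 0) :
    ∃ j : Fin 2, ∀ z : K, ∃ q : Polynomial K, q ≠ 0 ∧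
      q.natDegree ≤ max f.num.natDegree f.denom.natDegree ∧
        ∀ x : Fin 2 → K, x j = z → forms f x 1 = c → q.IsRoot (x (1 - j)) := by
  have hd := max_natDegree_pos hf
  set d := max f.num.natDegree f.denom.natDegree
  have hforms : ∀ x, forms f x 1 = MvPolynomial.eval x (f.denom.homogenize d) := fun x => rfl
  have hsubne : ∀ p : Polynomial K, p.eval 0 = 0 → p - Polynomial.C c ≠ 0 := by
    intro p hp h
    have := congrArg (Polynomial.eval 0) h
    simp [hp, hc] at this
  rcases Nat.eq_zero_or_pos f.denom.natDegree with h | h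
  · have h1 : f.denom = 1 := f.monic_denom.natDegree_eq_zero.mp h
    refine ⟨0, fun z => ⟨Polynomial.X ^ d - Polynomial.C c, hsubne _ (by simp [hd.ne']),
      (Polynomial.natDegree_X_pow_sub_C).le, fun x _ hx => ?_⟩⟩
    have hx1 : x (1 - 0) ≠ 0 := by
      intro h0
      rw [hforms, eval_homogenize_of_eq_zero _ _ _ h0, h1, Polynomial.coeff_one,
        if_neg hd.ne', zero_mul] at hx
      exact hc hx.symm
    rw [hforms, Polynomial.eval_homogenize (le_max_right _ _) _ hx1] at hx
    have he : f.denom.eval (x 0 / x 1) = 1 := by rw [h1, Polynomial.eval_one]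
    rw [he, one_mul] at hx
    rw [Polynomial.IsRoot, Polynomial.eval_sub, Polynomial.eval_pow, Polynomial.eval_X,
      Polynomial.eval_C, sub_eq_zero]
    exact hx
  · refine ⟨1, fun z => ?_⟩
    by_cases hz : z = 0
    · refine ⟨Polynomial.C (f.denom.coeff d) * Polynomial.X ^ d - Polynomial.C c,
        hsubne _ (by simp [hd.ne']), ?_, fun x hxz hx => ?_⟩
      · rw [Polynomial.natDegree_sub_C]
        exact Polynomial.natDegree_C_mul_X_pow_le _ _
      · rw [hforms, eval_homogenize_of_eq_zero _ _ _ (hxz.trans hz)] at hx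
        rw [Polynomial.IsRoot, Polynomial.eval_sub, Polynomial.eval_mul, Polynomial.eval_pow,
          Polynomial.eval_X, Polynomial.eval_C, Polynomial.eval_C, sub_eq_zero]
        exact hx
    · have hdeg : (Polynomial.C (z ^ d) * f.denom.comp (Polynomial.C z⁻¹ * Polynomial.X) -
          Polynomial.C c).natDegree = f.denom.natDegree := by
        rw [Polynomial.natDegree_sub_C, Polynomial.natDegree_C_mul (pow_ne_zero _ hz),
          Polynomial.natDegree_comp, Polynomial.natDegree_C_mul_X _ (inv_ne_zero hz), mul_one]
      refine ⟨Polynomial.C (z ^ d) * f.denom.comp (Polynomial.C z⁻¹ * Polynomial.X) -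
        Polynomial.C c, ?_, hdeg.le.trans (le_max_right _ _), fun x hxz hx => ?_⟩
      · intro h0
        rw [h0, Polynomial.natDegree_zero] at hdeg
        omega
      · rw [hforms, Polynomial.eval_homogenize (le_max_right _ _) _ (by rwa [hxz]), hxz] at hx
        rw [Polynomial.IsRoot, Polynomial.eval_sub, Polynomial.eval_mul, Polynomial.eval_comp,
          Polynomial.eval_mul, Polynomial.eval_X, Polynomial.eval_C, Polynomial.eval_C,
          Polynomial.eval_C, sub_eq_zero, mul_comm, ← hx, div_eq_inv_mul]
        rfl

section

variable {K : Type*} [Field K] [NumberField K]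

theorem finitePlace_le_one {v : FinitePlace K} {x : K}
    (h : v.maximalIdeal.valuation K x ≤ 1) : v x ≤ 1 := by
  rw [← FinitePlace.norm_embedding_eq, FinitePlace.norm_embedding, HeightOneSpectrum.adicAbv_def]
  have := HeightOneSpectrum.one_lt_absNorm_nnreal v.maximalIdeal
  exact_mod_cast (WithZeroMulInt.toNNReal_le_one_iff this).mpr h

theorem exists_mulHeight₁_coord_le (f : RatFunc K) (hf : ∀ c : K, f ≠ RatFunc.C c) {c : K}
    (hc : c ≠ 0) :
    ∃ E : ℝ, 1 ≤ E ∧ ∀ x : Fin 2 → K, forms f x 1 = c → ∀ B : ℝ, 0 ≤ B →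
      Height.mulHeight x ≤ B ^ Module.finrank ℚ K →
        ∀ i, Height.mulHeight₁ (x i) ≤ (E * B) ^ Module.finrank ℚ K := by
  have hd := max_natDegree_pos hf
  set d := max f.num.natDegree f.denom.natDegree
  have hn0 : 0 < Module.finrank ℚ K := Module.finrank_pos
  have hforms : ∀ x, forms f x 1 = MvPolynomial.eval x (f.denom.homogenize d) := fun x => rfl
  have hex : ∀ i : Fin 2, ∃ D > 0, ∀ x : Fin 2 → K, forms f x 1 = c →
      Height.mulHeight₁ (x i) ^ d ≤ D * Height.mulHeight x ^ d := by
    intro i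
    -- On `G = c` the point `[x i ^ d : 1]` equals `[x i ^ d : c⁻¹ G(x)]`, the value at `x` of two
    -- forms of degree `d`; the height bound for forms then applies.
    let p : Fin 2 → MvPolynomial (Fin 2) K :=
      ![MvPolynomial.X i ^ d, MvPolynomial.C c⁻¹ * f.denom.homogenize d]
    have hp : ∀ k, (p k).IsHomogeneous d := by
      intro k
      fin_cases k
      · simpa [p] using (MvPolynomial.isHomogeneous_X K i).pow d
      · simpa [p] using (MvPolynomial.isHomogeneous_C (Fin 2) c⁻¹).mul
          (Polynomial.isHomogeneous_homogenize f.denom (n := d))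
    obtain ⟨D, hD, hDle⟩ := Height.mulHeight_eval_le' hp
    refine ⟨D, hD, fun x hx => ?_⟩
    rw [← Height.mulHeight₁_pow, Height.mulHeight₁_eq_mulHeight]
    refine le_trans (le_of_eq ?_) (hDle x)
    congr 1
    ext k
    fin_cases k
    · simp [p]
    · simp [p, ← hforms, hx, hc]
  choose D hD hDle using hex
  refine ⟨max 1 (max (D 0) (D 1)), le_max_left _ _, fun x hx B hB hxB i => ?_⟩
  set E := max 1 (max (D 0) (D 1)) with hE
  have hE1 : 1 ≤ E := le_max_left _ _
  have hDE : D i ≤ E := by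
    refine le_trans ?_ (le_max_right _ _)
    fin_cases i
    · exact le_max_left _ _
    · exact le_max_right _ _
  refine le_of_pow_le_pow_left₀ hd.ne' (by positivity) ?_
  calc _ ≤ D i * Height.mulHeight x ^ d := hDle i x hx
    _ ≤ (E ^ Module.finrank ℚ K) ^ d * (B ^ Module.finrank ℚ K) ^ d := by
        refine mul_le_mul ?_ (pow_le_pow_left₀ (Height.mulHeight_pos x).le hxB d)
          (pow_nonneg (Height.mulHeight_pos x).le _) (by positivity)
        rw [← pow_mul]
        exact hDE.trans (le_self_pow₀ hE1 (Nat.mul_pos hn0 hd).ne')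
    _ = _ := by rw [← mul_pow, ← mul_pow]

/-- The points with integral coordinates at which the denominator takes the value `c`. -/
def levelPoints (f : RatFunc K) (T : Finset (FinitePlace K)) (c : K) : Set (ℙ K (Fin 2 → K)) :=
  {P | ∃ (x : Fin 2 → K) (hx : x ≠ 0), P = Projectivization.mk K x hx ∧ forms f x 1 = c ∧
    ∀ v ∉ T, ∀ i, v (x i) ≤ 1}

theorem exists_ncard_levelPoints_le (f : RatFunc K) (hf : ∀ c : K, f ≠ RatFunc.C c)
    (T : Finset (FinitePlace K)) {c : K} (hc : c ≠ 0) :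
    ∃ E : ℝ, 1 ≤ E ∧ ∀ B : ℝ, 0 ≤ B → (boundedHeight (levelPoints f T c) B).ncard ≤
      {z : K | (∀ v ∉ T, v z ≤ 1) ∧ Height.mulHeight₁ z ≤ (E * B) ^ Module.finrank ℚ K}.ncard *
        max f.num.natDegree f.denom.natDegree := by
  classical
  obtain ⟨E, hE, hEle⟩ := exists_mulHeight₁_coord_le f hf hc
  obtain ⟨j, hj⟩ := exists_fibre_polynomial f hf hc
  choose q hq0 hqd hq using hj
  refine ⟨E, hE, fun B hB => ?_⟩
  set Z := {z : K | (∀ v ∉ T, v z ≤ 1) ∧ Height.mulHeight₁ z ≤ (E * B) ^ Module.finrank ℚ K}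
  have hZ : Z.Finite := (NumberField.finite_setOfPred_mulHeight₁_le (K := K)
    ((E * B) ^ Module.finrank ℚ K)).subset fun z hz => hz.2
  -- The value at the zero vector is a dummy, needed only to make `π` total.
  let π : (Fin 2 → K) → ℙ K (Fin 2 → K) := fun x =>
    if hx : x ≠ 0 then Projectivization.mk K x hx else affinePoint 0
  have hsub : boundedHeight (levelPoints f T c) B ⊆ (hZ.toFinset.biUnion fun z =>
      (q z).roots.toFinset.image fun t => π (Function.update (fun _ => t) j z) : Finset _) := by
    rintro P ⟨⟨x, hx, rfl, hxc, hxT⟩, hPB⟩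
    rw [absHeight_le_iff hB, Projectivization.mulHeight_mk] at hPB
    have hup : Function.update (fun _ => x (1 - j)) j (x j) = x := by
      ext i
      by_cases h : i = j
      · rw [h, Function.update_self]
      · rw [Function.update_of_ne h]
        congr 1
        revert h
        fin_cases i <;> fin_cases j <;> simp
    simp only [Finset.coe_biUnion, Set.mem_iUnion, Finset.coe_image, Set.mem_image]
    refine ⟨x j, ?_, x (1 - j), ?_, ?_⟩
    · rw [Finset.mem_coe, Set.Finite.mem_toFinset]
      exact ⟨fun v hv => hxT v hv j, hEle x hxc B hB hPB j⟩
    · rw [Finset.mem_coe, Multiset.mem_toFinset, Polynomial.mem_roots (hq0 _)]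
      exact hq _ x rfl hxc
    · rw [hup]
      simp only [π, dif_pos hx]
  refine (Set.ncard_le_ncard hsub (Finset.finite_toSet _)).trans ?_
  rw [Set.ncard_coe_finset, Set.ncard_eq_toFinset_card Z hZ]
  exact Finset.card_biUnion_le_card_mul _ _ _ fun z _ =>
    Finset.card_image_le.trans ((Multiset.toFinset_card_le _).trans
      ((Polynomial.card_roots' _).trans (hqd z)))

theorem tendsto_log_add_one_pow_div_atTop (N : ℕ) :
    Tendsto (fun Y : ℝ => (Real.log Y + 1) ^ N / Y) atTop (𝓝 0) := by
  have h := (Real.isLittleO_pow_log_id_atTop (n := N)).tendsto_div_nhds_zero.const_mul ((2 : ℝ) ^ N)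
  rw [mul_zero] at h
  refine tendsto_of_tendsto_of_tendsto_of_le_of_le' tendsto_const_nhds h ?_ ?_
  · filter_upwards [eventually_ge_atTop 1] with Y hY
    have := Real.log_nonneg hY
    positivity
  · filter_upwards [eventually_ge_atTop (Real.exp 1)] with Y hY
    have hY0 : 0 < Y := (Real.exp_pos 1).trans_le hY
    have hlog : 1 ≤ Real.log Y := (Real.le_log_iff_exp_le hY0).mpr hY
    rw [id, ← mul_div_assoc, ← mul_pow]
    gcongr
    linarith

theorem tendsto_ncard_levelPoints_div (f : RatFunc K) (hf : ∀ c : K, f ≠ RatFunc.C c)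
    (T : Finset (FinitePlace K)) {c : K} (hc : c ≠ 0) :
    Tendsto (fun B : ℝ => ((boundedHeight (levelPoints f T c) B).ncard : ℝ) /
      B ^ (Module.finrank ℚ K + 1)) atTop (𝓝 0) := by
  set d := max f.num.natDegree f.denom.natDegree
  obtain ⟨E, hE, hEle⟩ := exists_ncard_levelPoints_le f hf T hc
  obtain ⟨A, N, hA, hAle⟩ := exists_ncard_integral_le T
  have hE0 : 0 < E := zero_lt_one.trans_le hE
  -- The limit is taken in `E * B`; the constant comes from `(E * B) ^ n / B ^ (n + 1) = E ^ (n + 1)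
  -- / (E * B)`.
  have h := ((tendsto_log_add_one_pow_div_atTop N).comp
    (tendsto_id.const_mul_atTop hE0)).const_mul (A * d * E ^ (Module.finrank ℚ K + 1))
  rw [mul_zero] at h
  refine tendsto_of_tendsto_of_tendsto_of_le_of_le' tendsto_const_nhds h ?_ ?_
  · filter_upwards [eventually_ge_atTop 0] with B hB
    positivity
  · filter_upwards [eventually_ge_atTop 1] with B hB
    have hB0 : 0 < B := by linarith
    have h1 := hEle B hB0.le
    have h2 := hAle (E * B) (one_le_mul_of_one_le_of_one_le hE hB)
    calc _ ≤ (A * (Real.log (E * B) + 1) ^ N * (E * B) ^ Module.finrank ℚ K) * d /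
          B ^ (Module.finrank ℚ K + 1) := by
          gcongr
          refine le_trans (by exact_mod_cast h1) (mul_le_mul_of_nonneg_right h2 (Nat.cast_nonneg d))
      _ = _ := by
          simp only [Function.comp, id]
          rw [mul_pow, pow_succ B, pow_succ E]
          field_simp

theorem tendsto_proportion_integralPreimage (f : RatFunc K) (hf : ∀ c : K, f ≠ RatFunc.C c)
    {S : Set (HeightOneSpectrum (𝓞 K))} (hS : S.Finite) :
    Tendsto (fun B : ℝ => proportion (integralPreimage f S) B) atTop (𝓝 0) := by
  classical
  obtain ⟨S', C, hS', hC, hC0, hrep⟩ := exists_integral_representatives f hf hS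
  let T : Finset (FinitePlace K) := hS'.toFinset.image FinitePlace.mk
  have hsub : ∀ B, boundedHeight (integralPreimage f S) B ⊆
      ⋃ c ∈ hC.toFinset, boundedHeight (levelPoints f T c) B := by
    rintro B P ⟨hP, hPB⟩
    obtain ⟨x, hx, hPx, hxC, hxS⟩ := hrep P hP
    refine Set.mem_biUnion (hC.mem_toFinset.mpr hxC) ⟨⟨x, hx, hPx, rfl, fun v hv i => ?_⟩, hPB⟩
    refine finitePlace_le_one (hxS _ (fun h => hv ?_) i)
    exact Finset.mem_image.mpr ⟨v.maximalIdeal, hS'.mem_toFinset.mpr h, v.mk_maximalIdeal⟩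
  have hcard : ∀ B, ((boundedHeight (integralPreimage f S) B).ncard : ℝ) ≤
      ∑ c ∈ hC.toFinset, ((boundedHeight (levelPoints f T c) B).ncard : ℝ) := by
    intro B
    have h := (Set.ncard_le_ncard (hsub B)
      (hC.toFinset.finite_toSet.biUnion fun c _ => boundedHeight_finite _ B)).trans
      (Finset.set_ncard_biUnion_le _ _)
    exact_mod_cast h
  obtain ⟨c₀, hc₀, B₀, hlow⟩ := exists_ncard_boundedHeight_univ_ge (K := K)
  have hlim := (tendsto_finsetSum hC.toFinset fun c hc => tendsto_ncard_levelPoints_div f hf T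
    (c := c) (by rintro rfl; exact hC0 (hC.mem_toFinset.mp hc))).const_mul c₀⁻¹
  rw [Finset.sum_const_zero, mul_zero] at hlim
  refine tendsto_of_tendsto_of_tendsto_of_le_of_le' tendsto_const_nhds hlim ?_ ?_
  · exact Eventually.of_forall fun B => (proportion_mem_Icc _ B).1
  · filter_upwards [eventually_ge_atTop B₀, eventually_gt_atTop 0] with B hB hB0
    calc proportion (integralPreimage f S) B
        ≤ (∑ c ∈ hC.toFinset, ((boundedHeight (levelPoints f T c) B).ncard : ℝ)) /
          (c₀ * B ^ (Module.finrank ℚ K + 1)) :=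
          div_le_div₀ (Finset.sum_nonneg fun c _ => Nat.cast_nonneg _) (hcard B) (by positivity)
            (hlow B hB)
      _ = _ := by
          rw [← Finset.sum_div]
          field_simp

end

end IntegralDensity


theorem mainTheorem7 {K : Type*} [Field K] [NumberField K] (f : RatFunc K)
    (hf : ∀ c : K, f ≠ RatFunc.C c)
    (S : Set (IsDedekindDomain.HeightOneSpectrum (NumberField.RingOfIntegers K)))
    (hS : S.Finite) :
    IntegralDensity.upperDensity (IntegralDensity.integralPreimage f S) = 0 :=
  (IntegralDensity.tendsto_proportion_integralPreimage f hf hS).limsup_eq
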